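/- \textbf{Setting.} Let $F$ be a non-Archimedean local field of characteristic zero and odd residue characteristic, with valuation $\mathrm{val}$ normalized by $\mathrm{val}(F^\times)=\mathbb Z$ and extended to all division algebras and field extensions below. Let $(D,\tau)$ be one of: (a) $D=F$, $\tau=\mathrm{id}$; (b) $D/F$ a quadratic field extension, $\tau$ its nontrivial automorphism; (c) $D$ the central quaternion division algebra over $F$, $\tau$ its main involution. Put $\mathfrak o_D=\{a:\mathrm{val}(a)\ge 0\}$, $\mathfrak p_D=\{a:\mathrm{val}(a)>0\}$. Let $\epsilon\in\{\pm1\}$, $\epsilon'=-\epsilon$, and let $V$ be a finite-dimensional right $D$-module with a nondegenerate $\epsilon$-Hermitian form $\langle\ ,\ \rangle_V$. Let $*$ be the adjoint on $\mathrm{End}_D(V)$, $G=\mathrm U(V)=\{g: gg^*=1\}$, $\mathfrak g=\{X\in \mathrm{End}_D(V): X+X^*=0\}$. For a right $D$-module $V'$ of finite dimension with a nondegenerate $\epsilon'$-Hermitian form and $w\in \mathrm{Hom}_D(V,V')$, let $w^\star\in\mathrm{Hom}_D(V',V)$ be defined by $\langle wv,v'\rangle_{V'}=\langle v,w^\star v'\rangle_V$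 and let $M(w)=w^\star w\in\mathfrak g$ be the moment map; put $G'=\mathrm U(V')$. A lattice function $\mathscr L$ in $V$ assigns to each $t\in\mathbb R$ an $\mathfrak o_D$-lattice $\mathscr L_t$ with $\mathscr L_t\supseteq\mathscr L_u$ for $t<u$, $\mathscr L_{t+\mathrm{val}(a)}=\mathscr L_ta$ for $a\in D^\times$, and $\mathscr L_t=\bigcap_{u<t}\mathscr L_u$; put $\mathscr L_{t^+}=\bigcup_{u>t}\mathscr L_u$ (and similarly for the other filtrations below). It is self-dual if $\{v:\langle v,\mathscr L_t\rangle_V\subseteq\mathfrak p_D\}=\mathscr L_{(-t)^+}$ for all $t$. The self-dual lattice functions in $V$ are the points $x$ of the Bruhat--Tits building of $G$. For $x$ corresponding to $\mathscr L$, let $\mathfrak g_{x,t}=\{X\in\mathfrak g: X\mathscr L_u\subseteq\mathscr L_{u+t}\ \forall u\in\mathbb R\}$; for self-dual $\mathscr L'$ in $V'$ let $\mathscr B=\mathscr L\otimes_D\mathscr L'$, i.e. $\mathscr B_t=\{w\in\mathrm{Hom}_D(V,V'): w\mathscr L_u\subseteq\mathscr L'_{u+t}\ \forall u\in\mathbb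 R\}$. Let $r>0$, $s=r/2$, and let $\Gamma\in\mathfrak g$ be semisimple. Write $F'[\Gamma]=\prod_jF_j$ as a product of fields, where $F'$ is the center of $D$, and assume that every component of $\Gamma$ has valuation $-r$. Let $x$, corresponding to $\mathscr L$, be a point of the building of the centralizer $G^0$ of $\Gamma$ in $G$; that is, $\mathscr L$ is a self-dual lattice function over $F'[\Gamma]$: if all components of $a\in F'[\Gamma]$ have valuation $\ge v$, then $a\mathscr L_t\subseteq\mathscr L_{t+v}$ for all $t$. (This covers the pair $(x,\Gamma)$ of every single block supercuspidal datum $(x,\Gamma,\phi,\rho)$ of positive depth $r$.) \textbf{Statement.} $\Gamma$ is invertible. Let $V_\Gamma$ be the $D$-module $V$ with the $\epsilon'$-Hermitian form $\langle v_1,\Gamma v_2\rangle_V$. Let $V'$ be any finite-dimensional nondegenerate $\epsilon'$-Hermitian right $D$-module. (1) Suppose $\dim_DV'=\dim_DV$. Let $\mathscr L'$ be a self-dual lattice function in $V'$, $\mathscr B=\mathscr L\otimes_D\mathscr L'$, and $w\in\mathscr B_{-s}$ with $M(w)\in\Gamma+\mathfrak g_{x,(-r)^+}$. Then $$M(w+\mathscr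 B_t)=M(w)+\mathfrak g_{x,-s+t}$$ for all real $t>-s$, and also $M(w+\mathscr B_{t^+})=M(w)+\mathfrak g_{x,(-s+t)^+}$ for all real $t\ge -s$. (2) Suppose $\dim_DV'=\dim_DV$ and that there is some $w\in\mathrm{Hom}_D(V,V')$ with $M(w)\in\Gamma+\mathfrak g_{x,(-r)^+}$. Then the set of self-dual lattice functions $\mathscr L'$ in $V'$ such that $$(\Gamma+\mathfrak g_{x,(-r)^+})\cap M\big((\mathscr L\otimes_D\mathscr L')_{-s}\big)\neq\emptyset$$ is a single (in particular nonempty) $G'$-orbit. (3) $\dim_DV'=\dim_DV$ and there is some $w\in\mathrm{Hom}_D(V,V')$ with $M(w)\in\Gamma+\mathfrak g_{x,(-r)^+}$ if and only if $V'$ is isometric to $V_\Gamma$. -/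

import Mathlib

open MulOpposite

/-! ### Valuations -/

section Valuations

/-- The absolute value of a uniformizer of the non-Archimedean local field `F`. -/
noncomputable def uniformizerNorm (F : Type*) [NontriviallyNormedField F] : ℝ :=
  sSup {y : ℝ | ∃ a : F, ‖a‖ < 1 ∧ y = ‖a‖}

open Classical in
/-- The valuation of a finite dimensional division algebra `D` over `F` which extends the
normalized valuation of `F` (the one with value group `ℤ`):
`val x = val_F (N_{D/F} x) / [D : F]`, and `val 0 = ∞`. -/
noncomputable def divVal (F : Type*) [NontriviallyNormedField F] {D : Type*} [DivisionRing D]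
    [Algebra F D] (x : D) : WithTop ℝ :=
  if x = 0 then ⊤ else
    ((Real.logb (uniformizerNorm F) ‖Algebra.norm F x‖ / (Module.finrank F D : ℝ) : ℝ) :
      WithTop ℝ)

open Classical in
/-- The extension of the normalized valuation of `F` to the algebraic closure of `F`
(`spectralNorm` is the unique multiplicative extension of the absolute value of `F`). -/
noncomputable def algVal (F : Type*) [NontriviallyNormedField F]
    (x : AlgebraicClosure F) : WithTop ℝ :=
  if x = 0 then ⊤ else
    ((Real.logb (uniformizerNorm F) (spectralNorm F (AlgebraicClosure F) x) : ℝ) : WithTop ℝ)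

end Valuations

/-! ### Division algebras with involution and Hermitian spaces -/

section Hermitian

/-- `τ` is an `F`-linear involution of the division algebra `D`, and `(D, τ)` is one of
(a) `D = F` and `τ = id`; (b) `D / F` is a quadratic field extension and `τ` is its nontrivial
automorphism; (c) `D` is the central quaternion division algebra over `F` and `τ` is its main
involution, i.e. `x + τ x` and `x * τ x` lie in `F` for every `x`. -/
structure IsTypeOneInvolution (F : Type*) [Field F] {D : Type*} [DivisionRing D] [Algebra F D]
    (τ : D → D) : Prop where
  map_add : ∀ a b, τ (a + b) = τ a + τ b
  map_mul : ∀ a b, τ (a * b) = τ b * τ a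
  commutes : ∀ c : F, τ (algebraMap F D c) = algebraMap F D c
  involutive : ∀ a, τ (τ a) = a
  cases :
    Module.finrank F D = 1 ∨
    (Module.finrank F D = 2 ∧ ∃ a, τ a ≠ a) ∨
    (Module.finrank F D = 4 ∧
      (∀ z : D, (∀ a, z * a = a * z) → ∃ c : F, algebraMap F D c = z) ∧
      ∀ a : D, (∃ c : F, algebraMap F D c = a + τ a) ∧ ∃ c : F, algebraMap F D c = a * τ a)

/-- A nondegenerate `ε`-Hermitian form on the right `D`-module `V`:
`⟨v a, w b⟩ = τ(a) ⟨v, w⟩ b` and `⟨v, w⟩ = ε τ(⟨w, v⟩)`. -/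
structure HermForm {D : Type*} [DivisionRing D] (τ : D → D) (ε : ℤˣ) (V : Type*)
    [AddCommGroup V] [Module Dᵐᵒᵖ V] where
  form : V → V → D
  add_left : ∀ u v w, form (u + v) w = form u w + form v w
  add_right : ∀ u v w, form u (v + w) = form u v + form u w
  smul_left : ∀ (a : D) (v w), form (op a • v) w = τ a * form v w
  smul_right : ∀ (a : D) (v w), form v (op a • w) = form v w * a
  herm : ∀ v w, form v w = ((ε : ℤ) : D) * τ (form w v)
  nondeg : ∀ w, (∀ v, form v w = 0) → w = 0

variable {D : Type*} [DivisionRing D] {τ : D → D} {ε ε' : ℤˣ}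
  {V : Type*} [AddCommGroup V] [Module Dᵐᵒᵖ V]
  {V' : Type*} [AddCommGroup V'] [Module Dᵐᵒᵖ V']

theorem HermForm.form_zero_right (h : HermForm τ ε V) (v : V) : h.form v 0 = 0 := by
  have := h.add_right v 0 0
  simpa using this

theorem HermForm.form_zero_left (h : HermForm τ ε V) (v : V) : h.form 0 v = 0 := by
  have := h.add_left 0 0 v
  simpa using this

theorem HermForm.form_neg_right (h : HermForm τ ε V) (v w : V) :
    h.form v (-w) = -h.form v w := by
  have := h.add_right v w (-w)
  rw [add_neg_cancel, h.form_zero_right] at this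
  exact (neg_eq_of_add_eq_zero_right this.symm).symm

theorem HermForm.ext_right (h : HermForm τ ε V) {x y : V}
    (hxy : ∀ v, h.form v x = h.form v y) : x = y := by
  rw [← sub_eq_zero]
  refine h.nondeg _ fun v => ?_
  rw [sub_eq_add_neg, h.add_right, h.form_neg_right, hxy v, add_neg_cancel]

theorem HermForm.exists_repr [Module.Finite Dᵐᵒᵖ V] (h : HermForm τ ε V)
    (h' : HermForm τ ε' V') (w : V →ₗ[Dᵐᵒᵖ] V') (v' : V') :
    ∃ u : V, ∀ v, h'.form (w v) v' = h.form v u := by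
  let b := Module.finBasis Dᵐᵒᵖ V
  let Ψ : V →ₗ[Dᵐᵒᵖ] (Fin (Module.finrank Dᵐᵒᵖ V) → Dᵐᵒᵖ) :=
    { toFun := fun v i => op (h.form (b i) v)
      map_add' := fun x y => by
        ext i
        simp [h.add_right]
      map_smul' := fun a x => by
        ext i
        induction a using MulOpposite.rec' with
        | h a => simp [h.smul_right] }
  have key : ∀ (f g : V → D), (∀ x y, f (x + y) = f x + f y) → (∀ x y, g (x + y) = g x + g y) →
      f 0 = 0 → g 0 = 0 →
      (∀ (a : D) x, f (op a • x) = τ a * f x) → (∀ (a : D) x, g (op a • x) = τ a * g x) →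
      (∀ i, f (b i) = g (b i)) → ∀ v, f v = g v := by
    intro f g fa ga f0 g0 fs gs hb v
    have hv : v ∈ Submodule.span Dᵐᵒᵖ (Set.range b) := by
      rw [b.span_eq]
      exact Submodule.mem_top
    induction hv using Submodule.span_induction with
    | mem x hx =>
      obtain ⟨i, rfl⟩ := hx
      exact hb i
    | zero => rw [f0, g0]
    | add x y _ _ hx hy => rw [fa, ga, hx, hy]
    | smul a x _ hx =>
      induction a using MulOpposite.rec' with
      | h a => rw [fs, gs, hx]
  have hinj : Function.Injective Ψ := by
    rw [← LinearMap.ker_eq_bot, LinearMap.ker_eq_bot']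
    intro m hm
    refine h.nondeg m ?_
    have hb : ∀ i, h.form (b i) m = 0 := fun i => by
      have := congrFun hm i
      exact op_injective this
    refine key (fun v => h.form v m) (fun _ => 0) (fun x y => h.add_left x y m) (by simp)
      (h.form_zero_left m) rfl (fun a x => h.smul_left a x m) (by simp) hb
  have hsurj : Function.Surjective Ψ :=
    (LinearMap.injective_iff_surjective_of_finrank_eq_finrank (by simp)).1 hinj
  obtain ⟨u, hu⟩ := hsurj fun i => op (h'.form (w (b i)) v')
  refine ⟨u, key (fun v => h'.form (w v) v') (fun v => h.form v u) ?_ ?_ ?_ ?_ ?_ ?_ ?_⟩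
  · intro x y
    simp [h'.add_left]
  · intro x y
    exact h.add_left x y u
  · simp [h'.form_zero_left]
  · exact h.form_zero_left u
  · intro a x
    simp [h'.smul_left]
  · intro a x
    exact h.smul_left a x u
  · intro i
    exact (op_injective (congrFun hu i)).symm

/-- The adjoint `w⋆ : V' → V` of `w : V → V'`, defined by `⟨w v, v'⟩_{V'} = ⟨v, w⋆ v'⟩_V`. -/
noncomputable def adj [Module.Finite Dᵐᵒᵖ V] (h : HermForm τ ε V) (h' : HermForm τ ε' V')
    (w : V →ₗ[Dᵐᵒᵖ] V') : V' →ₗ[Dᵐᵒᵖ] V where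
  toFun v' := (h.exists_repr h' w v').choose
  map_add' x y := by
    refine h.ext_right fun v => ?_
    rw [← (h.exists_repr h' w (x + y)).choose_spec v, h.add_right,
      ← (h.exists_repr h' w x).choose_spec v, ← (h.exists_repr h' w y).choose_spec v,
      h'.add_right]
  map_smul' a x := by
    refine h.ext_right fun v => ?_
    induction a using MulOpposite.rec' with
    | h a =>
      rw [← (h.exists_repr h' w (op a • x)).choose_spec v, RingHom.id_apply, h.smul_right,
        ← (h.exists_repr h' w x).choose_spec v, h'.smul_right]

theorem adj_spec [Module.Finite Dᵐᵒᵖ V] (h : HermForm τ ε V) (h' : HermForm τ ε' V')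
    (w : V →ₗ[Dᵐᵒᵖ] V') (v : V) (v' : V') :
    h'.form (w v) v' = h.form v (adj h h' w v') :=
  (h.exists_repr h' w v').choose_spec v

/-- The isometry group `U(V) = {g | g g⋆ = 1}`, as a subset of `End_D(V)`. -/
def unitarySet [Module.Finite Dᵐᵒᵖ V] (h : HermForm τ ε V) : Set (Module.End Dᵐᵒᵖ V) :=
  {g | g * adj h h g = 1}

/-- The Lie algebra `𝔲(V) = {X | X + X⋆ = 0}`, as a subset of `End_D(V)`. -/
def lieU [Module.Finite Dᵐᵒᵖ V] (h : HermForm τ ε V) : Set (Module.End Dᵐᵒᵖ V) :=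
  {X | X + adj h h X = 0}

/-- The moment map `M(w) = w⋆ w` on `W = Hom_D(V, V')`. -/
noncomputable def momentMap [Module.Finite Dᵐᵒᵖ V] (h : HermForm τ ε V) (h' : HermForm τ ε' V')
    (w : V →ₗ[Dᵐᵒᵖ] V') : Module.End Dᵐᵒᵖ V :=
  (adj h h' w).comp w

theorem lieU_skew [Module.Finite Dᵐᵒᵖ V] {h : HermForm τ ε V} {X : Module.End Dᵐᵒᵖ V}
    (hX : X ∈ lieU h) (v w : V) : h.form (X v) w = -h.form v (X w) := by
  have h1 : adj h h X w = -X w := by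
    have := LinearMap.congr_fun (show X + adj h h X = 0 from hX) w
    rw [LinearMap.add_apply, LinearMap.zero_apply] at this
    exact (neg_eq_of_add_eq_zero_right this).symm
  rw [adj_spec h h X v w, h1, h.form_neg_right]

/-- The `(-ε)`-Hermitian space `V_Γ`: the `D`-module `V` with the form
`⟨v₁, v₂⟩_Γ = ⟨v₁, Γ v₂⟩`, for an invertible `Γ ∈ 𝔲(V)`. -/
def gammaForm [Module.Finite Dᵐᵒᵖ V] (h : HermForm τ ε V) {Γ : Module.End Dᵐᵒᵖ V}
    (hΓ : Γ ∈ lieU h) (hu : IsUnit Γ) : HermForm τ (-ε) V where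
  form v w := h.form v (Γ w)
  add_left u v w := h.add_left u v (Γ w)
  add_right u v w := by rw [_root_.map_add, h.add_right]
  smul_left a v w := h.smul_left a v (Γ w)
  smul_right a v w := by rw [map_smul, h.smul_right]
  herm v w := by
    have h1 := lieU_skew hΓ v w
    rw [h.herm (Γ v) w] at h1
    rw [← neg_eq_iff_eq_neg.2 h1]
    simp
  nondeg w hw := by
    have h1 : Γ w = 0 := h.nondeg (Γ w) hw
    exact ((Module.End.isUnit_iff Γ).1 hu).injective (by rw [h1, _root_.map_zero])

/-- Two Hermitian spaces are isometric. -/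
def Isometric (h : HermForm τ ε V) (h' : HermForm τ ε V') : Prop :=
  ∃ e : V ≃ₗ[Dᵐᵒᵖ] V', ∀ x y, h'.form (e x) (e y) = h.form x y

end Hermitian

/-! ### Lattice functions and the associated filtrations -/

section Lattices

variable (F : Type*) [NontriviallyNormedField F] {D : Type*} [DivisionRing D] [Algebra F D]
  {τ : D → D} {ε : ℤˣ} {V : Type*} [AddCommGroup V] [Module Dᵐᵒᵖ V]
  {V' : Type*} [AddCommGroup V'] [Module Dᵐᵒᵖ V']

/-- `Λ` is an `𝔬_D`-lattice in `V`: it is the `𝔬_D`-span of a finite subset of `V` which spans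
`V` over `D`. Here `𝔬_D = {a | 0 ≤ val a}`. -/
def IsDLattice (Λ : AddSubgroup V) : Prop :=
  ∃ S : Finset V, Submodule.span Dᵐᵒᵖ (S : Set V) = ⊤ ∧
    Λ = AddSubgroup.closure {x : V | ∃ v ∈ S, ∃ a : D, 0 ≤ divVal F a ∧ x = op a • v}

/-- Lattice functions `t ↦ L t` in `V`, restricted to real indices; the values
`L (t⁺) = ⋃_{u > t} L u` at the remaining indices are determined by these. -/
structure IsLatticeFunction (L : ℝ → AddSubgroup V) : Prop where
  isLattice : ∀ t, IsDLattice F (D := D) (L t)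
  anti : ∀ t u, t < u → L u ≤ L t
  smul : ∀ (t v : ℝ) (a : D), divVal F a = (v : WithTop ℝ) →
    (L (t + v) : Set V) = (fun x => op a • x) '' (L t : Set V)
  left_cont : ∀ t, (L t : Set V) = ⋂ u < t, (L u : Set V)

/-- The lattice function `L` is self-dual: `(L t)^* = L ((-t)⁺)` for all `t`, where
`Λ^* = {v | ⟨v, Λ⟩ ⊆ 𝔭_D}` and `𝔭_D = {a | 0 < val a}`. The self-dual lattice functions are
the points of the Bruhat-Tits building of `U(V)`. -/
structure IsSelfDualLatticeFunction (h : HermForm τ ε V) (L : ℝ → AddSubgroup V) : Prop where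
  isLatticeFunction : IsLatticeFunction F (D := D) L
  self_dual : ∀ t, {v : V | ∀ x ∈ L t, 0 < divVal F (h.form v x)} = ⋃ u > -t, (L u : Set V)

end Lattices

section Filtrations

variable {D : Type*} [DivisionRing D]
  {τ : D → D} {ε : ℤˣ} {V : Type*} [AddCommGroup V] [Module Dᵐᵒᵖ V]
  {V' : Type*} [AddCommGroup V'] [Module Dᵐᵒᵖ V']

/-- The lattice `(L ⊗_D L')_t = ⋂_u Hom_{𝔬_D}(L u, L' (u + t))` in
`W = V ⊗_D V' = Hom_D(V, V')`. For `L' = L` this is the lattice `𝔤𝔩(V)_{x,t}`. -/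
def homLattice (L : ℝ → AddSubgroup V) (L' : ℝ → AddSubgroup V') (t : ℝ) :
    Set (V →ₗ[Dᵐᵒᵖ] V') :=
  {w | ∀ u : ℝ, ∀ v ∈ L u, w v ∈ L' (u + t)}

/-- `(L ⊗_D L')_{t⁺}`. -/
def homLatticePlus (L : ℝ → AddSubgroup V) (L' : ℝ → AddSubgroup V') (t : ℝ) :
    Set (V →ₗ[Dᵐᵒᵖ] V') :=
  ⋃ u > t, homLattice L L' u

/-- The Moy-Prasad lattice `𝔤_{x,t}` in `𝔤 = 𝔲(V)`, where the point `x` of the building is given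
by the self-dual lattice function `L`. -/
def lieFiltration [Module.Finite Dᵐᵒᵖ V] (h : HermForm τ ε V) (L : ℝ → AddSubgroup V) (t : ℝ) :
    Set (Module.End Dᵐᵒᵖ V) :=
  lieU h ∩ homLattice L L t

/-- `𝔤_{x,t⁺}`. -/
def lieFiltrationPlus [Module.Finite Dᵐᵒᵖ V] (h : HermForm τ ε V) (L : ℝ → AddSubgroup V)
    (t : ℝ) : Set (Module.End Dᵐᵒᵖ V) :=
  ⋃ u > t, lieFiltration h L u

end Filtrations

/-! ### The commutative algebra generated by `Γ` -/

section GammaAlgebra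

variable (F : Type*) [NontriviallyNormedField F] {D : Type*} [DivisionRing D] [Algebra F D]
  {V : Type*} [AddCommGroup V] [Module Dᵐᵒᵖ V] [Module F V] [IsScalarTower F Dᵐᵒᵖ V]

/-- The algebra `F'[Γ]`, where `F'` is the center of `D`, identified with the center of
`End_D(V)`. For semisimple `Γ` it is a product of fields `∏ F_j`. -/
def gammaAlgebra (Γ : Module.End Dᵐᵒᵖ V) : Subalgebra F (Module.End Dᵐᵒᵖ V) :=
  Algebra.adjoin F (insert Γ (Set.center (Module.End Dᵐᵒᵖ V)))

/-- Every component of `Γ` in `F'[Γ] = ∏ F_j` has valuation `-r`. The components of an element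
`a ∈ F'[Γ]` and their valuations are read off from the `F`-algebra homomorphisms of `F'[Γ]` to
the algebraic closure of `F`: each of them is a projection to some `F_j` followed by an
embedding of `F_j`, and every embedding of every `F_j` arises. -/
def IsSingleBlock (Γ : Module.End Dᵐᵒᵖ V) (r : ℝ) : Prop :=
  ∀ f : gammaAlgebra F Γ →ₐ[F] AlgebraicClosure F,
    algVal F (f ⟨Γ, Algebra.subset_adjoin (Set.mem_insert _ _)⟩) = ((-r : ℝ) : WithTop ℝ)

/-- The lattice function `L` comes from the building of the centralizer of `Γ`: it is a lattice
function over `F'[Γ] = ∏ F_j`, i.e. it is the direct sum of lattice functions `L_j` in the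
`(F_j, D)`-bimodules `V_j = F_j V`, with `a (L_j t) = L_j (t + val a)` for `a ∈ F_j^×`. This is
expressed by: if all components of `a ∈ F'[Γ]` have valuation `≥ v`, then
`a (L t) ⊆ L (t + v)`. -/
def IsGammaLatticeFunction (Γ : Module.End Dᵐᵒᵖ V) (L : ℝ → AddSubgroup V) : Prop :=
  ∀ (a : gammaAlgebra F Γ) (v : ℝ),
    (∀ f : gammaAlgebra F Γ →ₐ[F] AlgebraicClosure F, (v : WithTop ℝ) ≤ algVal F (f a)) →
    (a : Module.End Dᵐᵒᵖ V) ∈ homLattice L L v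

end GammaAlgebra

/-! ### Valuations of scalars -/

section ScalarValuations

variable (F : Type*) [NontriviallyNormedField F]

/-! Since `Γ` and its inverse `Δ` shift the lattice function by `-r` and `r`, every `Y` in `Γ +
𝔤_{x,(-r)⁺}` equals `Γ` times a perturbation of the identity by a topologically nilpotent map, and
so carries `L u` onto `L (u - r)` (`ShiftsLattices.perturb`). If `Y = M(w)`, this makes `w`
injective, and bijective when the dimensions agree.

Surjectivity of the moment map (`exists_momentMap_add_eq`) comes from `M(w + b) - M(w) = w⋆b + b⋆w +
b⋆b`. With `Y Z = 1`, the choice `b = ½ w Z Q` gives `w⋆b = ½ Q`, and skewness of `Q` gives `b⋆w = ½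
Q` as well. Taking `Q = X - b⋆b` turns the required identity into a fixed-point equation for `b`,
which is contracting exactly because `t > -s`; it is solved by completeness (`exists_fixedPoint`).
Division by 2 is harmless since 2 is a unit.

The rest follows from two remarks. The image `u ↦ w (L (u + s))` is self-dual, because `w`
transports the form of `V'` to `⟨x, M(w) y⟩` and `M(w)` shifts by `-2s`; conversely, any admissible
`L'` with `w ∈ B_{-s}` equals this image (`exists_apply_eq_of_mem`). And surjectivity corrects `w`
to some `e` with `M(e) = Γ` exactly, that is, to an isometry from `V_Γ`. Two such isometries differ
by an element of `U(V')`, which gives the single orbit. -/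

theorem uniformizerNorm_pos : 0 < uniformizerNorm F := by
  obtain ⟨a, ha0, ha1⟩ := NormedField.exists_norm_lt_one F
  refine ha0.trans_le (le_csSup ⟨1, ?_⟩ ⟨a, ha1, rfl⟩)
  rintro y ⟨b, hb, rfl⟩
  exact hb.le

theorem uniformizerNorm_lt_one [IsUltrametricDist F] [LocallyCompactSpace F] :
    uniformizerNorm F < 1 := by
  have : ProperSpace F := ProperSpace.of_locallyCompactSpace F
  -- Discreteness of the valuation: the open unit ball is also closed, hence compact, so the norm
  -- attains its maximum on it, at a point of norm less than 1.
  have hc : IsCompact (Metric.ball (0 : F) 1) :=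
    Metric.isCompact_of_isClosed_isBounded (IsUltrametricDist.isClosed_ball _ _)
      Metric.isBounded_ball
  obtain ⟨a, ha, hmax⟩ := hc.exists_isMaxOn ⟨0, by simp⟩ continuous_norm.continuousOn
  refine lt_of_le_of_lt (csSup_le ⟨0, 0, by simp⟩ ?_) (by simpa using ha : ‖a‖ < 1)
  rintro y ⟨b, hb, rfl⟩
  exact hmax (by simpa using hb)

theorem divVal_algebraMap {D : Type*} [DivisionRing D] [Algebra F D]
    (hD : Module.finrank F D ≠ 0) {a : F} (ha : a ≠ 0) :
    divVal F (algebraMap F D a) = (Real.logb (uniformizerNorm F) ‖a‖ : ℝ) := by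
  have hn : (Module.finrank F D : ℝ) ≠ 0 := by exact_mod_cast hD
  rw [divVal, if_neg (by simpa using ha), Algebra.norm_algebraMap, norm_pow, Real.logb_pow,
    mul_div_cancel_left₀ _ hn]

theorem divVal_one {D : Type*} [DivisionRing D] [Algebra F D] :
    divVal F (1 : D) = 0 := by
  simp [divVal]

theorem divVal_neg {D : Type*} [DivisionRing D] [Algebra F D] (a : D) :
    divVal F (-a) = divVal F a := by
  have h1 : ‖Algebra.norm F (-1 : D)‖ = 1 := by
    have : ‖Algebra.norm F (-1 : D)‖ ^ 2 = 1 := by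
      rw [← norm_pow, ← map_pow]
      simp
    exact (pow_eq_one_iff_of_nonneg (norm_nonneg _) two_ne_zero).1 this
  have h2 : ‖Algebra.norm F (-a)‖ = ‖Algebra.norm F a‖ := by
    rw [← neg_one_mul, map_mul, norm_mul, h1, one_mul]
  rcases eq_or_ne a 0 with rfl | ha
  · rw [neg_zero]
  · rw [divVal, divVal, if_neg ha, if_neg (neg_ne_zero.2 ha), h2]

theorem exists_divVal_eq {D : Type*} [DivisionRing D] [Algebra F D] {a : D} (ha : a ≠ 0) :
    ∃ v : ℝ, divVal F a = (v : WithTop ℝ) := by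
  rw [divVal, if_neg ha]
  exact ⟨_, rfl⟩

theorem algVal_inv [IsUltrametricDist F] [CompleteSpace F] {x : AlgebraicClosure F} (hx : x ≠ 0)
    {v : ℝ} (hv : algVal F x = (v : WithTop ℝ)) : algVal F x⁻¹ = ((-v : ℝ) : WithTop ℝ) := by
  rw [algVal, if_neg hx, WithTop.coe_inj] at hv
  have h1 : spectralNorm F (AlgebraicClosure F) x * spectralNorm F (AlgebraicClosure F) x⁻¹
      = 1 := by
    have := spectralAlgNorm_mul (K := F) x x⁻¹
    simp only [spectralAlgNorm_def] at this
    rw [← this, mul_inv_cancel₀ hx, spectralNorm_one]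
  rw [algVal, if_neg (inv_ne_zero hx), WithTop.coe_inj, ← hv, ← Real.logb_inv,
    eq_inv_of_mul_eq_one_right h1]

theorem tendsto_uniformizerNorm_rpow [IsUltrametricDist F] [LocallyCompactSpace F] :
    Filter.Tendsto (fun n : ℕ => uniformizerNorm F ^ (n : ℝ)) Filter.atTop (nhds 0) := by
  simpa using tendsto_pow_atTop_nhds_zero_of_lt_one (uniformizerNorm_pos F).le
    (uniformizerNorm_lt_one F)

end ScalarValuations

/-! ### Contractions of filtered vector spaces -/

section Contraction

/-- A decreasing, exhaustive and separated filtration of an `F`-vector space by additive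
subgroups which is compatible with the valuation of `F`. -/
structure IsValuedFiltration (F : Type*) [NontriviallyNormedField F] {E : Type*}
    [AddCommGroup E] [Module F E] (L : ℝ → AddSubgroup E) : Prop where
  anti : Antitone L
  smul_mem : ∀ (a : F), a ≠ 0 → ∀ (t : ℝ), ∀ x ∈ L t,
    a • x ∈ L (t + Real.logb (uniformizerNorm F) ‖a‖)
  exhaustive : ∀ x, ∃ t, x ∈ L t
  separated : ∀ x, (∀ t, x ∈ L t) → x = 0

variable {F : Type*} [NontriviallyNormedField F] {E : Type*} [AddCommGroup E]
  {L : ℝ → AddSubgroup E}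

namespace IsValuedFiltration

/-- The norm attached to a filtration. -/
noncomputable def gauge (F : Type*) [NontriviallyNormedField F] {E : Type*} [AddCommGroup E]
    (L : ℝ → AddSubgroup E) (x : E) : ℝ :=
  sInf {y : ℝ | ∃ t : ℝ, x ∈ L t ∧ y = uniformizerNorm F ^ t}

theorem gauge_nonneg (x : E) : 0 ≤ gauge F L x :=
  Real.sInf_nonneg (by
    rintro y ⟨t, -, rfl⟩
    exact (Real.rpow_pos_of_pos (uniformizerNorm_pos F) t).le)

theorem gauge_le {x : E} {t : ℝ} (hx : x ∈ L t) : gauge F L x ≤ uniformizerNorm F ^ t :=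
  csInf_le ⟨0, by
    rintro y ⟨t, -, rfl⟩
    exact (Real.rpow_pos_of_pos (uniformizerNorm_pos F) t).le⟩ ⟨t, hx, rfl⟩

theorem gauge_neg (x : E) : gauge F L (-x) = gauge F L x := by
  simp only [gauge, neg_mem_iff]

theorem exists_of_gauge_lt [Module F E] (hL : IsValuedFiltration F L) {x : E} {y : ℝ}
    (hx : gauge F L x < y) : ∃ t, x ∈ L t ∧ uniformizerNorm F ^ t < y := by
  obtain ⟨t, ht⟩ := hL.exhaustive x
  obtain ⟨_, ⟨u, hu, rfl⟩, h⟩ := exists_lt_of_csInf_lt (by exact ⟨_, t, ht, rfl⟩) hx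
  exact ⟨u, hu, h⟩

theorem gauge_add_le [Module F E] (hL : IsValuedFiltration F L)
    (x y : E) : gauge F L (x + y) ≤ gauge F L x + gauge F L y := by
  refine le_of_forall_pos_lt_add fun e he => ?_
  obtain ⟨t, ht, h1⟩ := hL.exists_of_gauge_lt (lt_add_of_pos_right (gauge F L x) he)
  obtain ⟨u, hu, h2⟩ := hL.exists_of_gauge_lt (lt_add_of_pos_right (gauge F L y) he)
  have hx := gauge_nonneg (F := F) (L := L) x
  have hy := gauge_nonneg (F := F) (L := L) y
  rcases le_total t u with h | h
  -- The sum lies in the step with the smaller index, so its gauge is bounded by one of the two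
  -- terms; the weaker triangle inequality is all that a norm needs.
  · have := gauge_le (F := F) (add_mem ht (hL.anti h hu))
    linarith
  · have := gauge_le (F := F) (add_mem (hL.anti h ht) hu)
    linarith

variable [IsUltrametricDist F] [LocallyCompactSpace F]

theorem mem_of_gauge_lt [Module F E] (hL : IsValuedFiltration F L)
    {x : E} {t : ℝ} (hx : gauge F L x < uniformizerNorm F ^ t) :
    x ∈ L t := by
  obtain ⟨u, hu, h⟩ := hL.exists_of_gauge_lt hx
  exact hL.anti ((Real.rpow_lt_rpow_left_iff_of_base_lt_one (uniformizerNorm_pos F)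
    (uniformizerNorm_lt_one F)).1 h).le hu

theorem gauge_zero : gauge F L 0 = 0 :=
  le_antisymm (ge_of_tendsto' (tendsto_uniformizerNorm_rpow F) fun _ => gauge_le (zero_mem _))
    (gauge_nonneg _)

theorem eq_zero_of_gauge_eq_zero [Module F E] (hL : IsValuedFiltration F L)
    {x : E} (hx : gauge F L x = 0) : x = 0 :=
  hL.separated x fun t =>
    hL.mem_of_gauge_lt (by rw [hx]; exact Real.rpow_pos_of_pos (uniformizerNorm_pos F) t)

theorem gauge_smul_le [Module F E] (hL : IsValuedFiltration F L)
    (a : F) (x : E) : gauge F L (a • x) ≤ ‖a‖ * gauge F L x := by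
  rcases eq_or_ne a 0 with rfl | ha
  · simp [gauge_zero]
  have ha' : 0 < ‖a‖ := norm_pos_iff.2 ha
  refine le_of_forall_gt fun y hy => ?_
  rw [← lt_div_iff₀' ha'] at hy
  obtain ⟨t, ht, h⟩ := hL.exists_of_gauge_lt hy
  refine (gauge_le (hL.smul_mem a ha t x ht)).trans_lt ?_
  rw [Real.rpow_add (uniformizerNorm_pos F), Real.rpow_logb (uniformizerNorm_pos F)
    (uniformizerNorm_lt_one F).ne ha']
  exact (lt_div_iff₀ ha').1 h

/-- A Cauchy sequence of a finite dimensional filtered space converges. -/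
theorem exists_limit [Module F E] (hL : IsValuedFiltration F L)
    [FiniteDimensional F E] (x : ℕ → E) {t₀ δ : ℝ} (hδ : 0 < δ)
    (hx : ∀ n : ℕ, x n - x (n + 1) ∈ L (t₀ + n * δ)) :
    ∃ y, ∀ t, ∃ n, ∀ m ≥ n, x m - y ∈ L t := by
  have hc := uniformizerNorm_pos F
  -- The gauge makes `E` a finite-dimensional normed space over a complete field, hence a complete
  -- one.
  let N : AddGroupNorm E :=
    { toFun := gauge F L
      map_zero' := gauge_zero
      add_le' := hL.gauge_add_le
      neg' := gauge_neg
      eq_zero_of_map_eq_zero' := fun _ h => hL.eq_zero_of_gauge_eq_zero h }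
  let : NormedAddCommGroup E := N.toNormedAddCommGroup
  let : NormedSpace F E := { norm_smul_le := hL.gauge_smul_le }
  have : ProperSpace F := ProperSpace.of_locallyCompactSpace F
  have : CompleteSpace E := FiniteDimensional.complete F E
  have hcs : CauchySeq x := by
    refine cauchySeq_of_le_geometric (uniformizerNorm F ^ δ) (uniformizerNorm F ^ t₀)
      (Real.rpow_lt_one hc.le (uniformizerNorm_lt_one F) hδ) fun n => ?_
    rw [dist_eq_norm]
    refine (gauge_le (hx n)).trans_eq ?_
    rw [Real.rpow_add hc, mul_comm (n : ℝ), Real.rpow_mul hc.le, Real.rpow_natCast]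
  obtain ⟨y, hy⟩ := cauchySeq_tendsto_of_complete hcs
  refine ⟨y, fun t => ?_⟩
  obtain ⟨n, hn⟩ := Metric.tendsto_atTop.1 hy _ (Real.rpow_pos_of_pos hc t)
  refine ⟨n, fun m hm => hL.mem_of_gauge_lt ?_⟩
  have := hn m hm
  rwa [dist_eq_norm] at this

/-- A contraction of a step of the filtration has a fixed point. -/
theorem exists_fixedPoint [Module F E] (hL : IsValuedFiltration F L)
    [FiniteDimensional F E] (T : E → E) {t₀ δ : ℝ} (hδ : 0 < δ)
    (hT : ∀ x ∈ L t₀, T x ∈ L t₀)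
    (hc : ∀ x ∈ L t₀, ∀ y ∈ L t₀, ∀ u, x - y ∈ L u → T x - T y ∈ L (u + δ)) :
    ∃ x ∈ L t₀, T x = x := by
  -- Picard iteration from 0, which lies in every step of the filtration.
  let x : ℕ → E := fun n => T^[n] 0
  have hsucc : ∀ n, x (n + 1) = T (x n) := fun n => Function.iterate_succ_apply' T n 0
  have hmem : ∀ n, x n ∈ L t₀ := by
    intro n
    induction n with
    | zero => exact zero_mem _
    | succ n ih => rw [hsucc]; exact hT _ ih
  have hdiff : ∀ n : ℕ, x n - x (n + 1) ∈ L (t₀ + n * δ) := by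
    intro n
    induction n with
    | zero => simpa using sub_mem (hmem 0) (hmem 1)
    | succ n ih =>
      have := hc _ (hmem n) _ (hmem (n + 1)) _ ih
      rw [← hsucc, ← hsucc] at this
      convert this using 2
      push_cast
      ring
  obtain ⟨y, hy⟩ := hL.exists_limit x hδ hdiff
  have hyt : y ∈ L t₀ := by
    obtain ⟨n, hn⟩ := hy t₀
    simpa using sub_mem (hmem n) (hn n le_rfl)
  -- Modulo each `L t`, both `y` and `T y` agree with `x (n + 1)` for large `n`.
  refine ⟨y, hyt, sub_eq_zero.1 (hL.separated _ fun t => ?_)⟩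
  obtain ⟨n, hn⟩ := hy t
  have h1 := hL.anti (by linarith : t ≤ t + δ) (hc _ (hmem n) _ hyt _ (hn n le_rfl))
  have h2 := hn (n + 1) (by lia)
  rw [hsucc] at h2
  have := sub_mem h2 h1
  simpa using this

end IsValuedFiltration

end Contraction

/-! ### Invertibility of `Γ` and the shift effected by its inverse -/

section GammaUnit

variable {F : Type*} [NontriviallyNormedField F]
  {D : Type*} [DivisionRing D] [Algebra F D]
  {V : Type*} [AddCommGroup V] [Module Dᵐᵒᵖ V] [Module F V] [IsScalarTower F Dᵐᵒᵖ V]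

/-- An element of a commutative finite dimensional algebra which is not annihilated by any
homomorphism to an algebraic closure is a unit. -/
theorem isUnit_of_forall_algHom_ne_zero {K A : Type*} [Field K] [CommRing A] [Algebra K A]
    [Module.Finite K A] (a : A) (ha : ∀ f : A →ₐ[K] AlgebraicClosure K, f a ≠ 0) : IsUnit a := by
  by_contra hn
  obtain ⟨I, hI, haI⟩ := exists_max_ideal_of_mem_nonunits hn
  -- The residue field is finite over `K`, so it embeds into the algebraic closure, giving a
  -- homomorphism that kills `a`.
  let : Field (A ⧸ I) := Ideal.Quotient.field I
  let g : (A ⧸ I) →ₐ[K] AlgebraicClosure K := IsAlgClosed.lift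
  refine ha (g.comp (Ideal.Quotient.mkₐ K I)) ?_
  have : Ideal.Quotient.mkₐ K I a = 0 := Ideal.Quotient.eq_zero_iff_mem.2 haI
  rw [AlgHom.comp_apply, this, map_zero]

theorem finite_linearMap {V' : Type*} [AddCommGroup V'] [Module Dᵐᵒᵖ V'] [Module F V']
    [IsScalarTower F Dᵐᵒᵖ V'] [Module.Finite F V] [Module.Finite F V'] :
    Module.Finite F (V →ₗ[Dᵐᵒᵖ] V') :=
  Module.Finite.of_injective (LinearMap.restrictScalarsₗ F Dᵐᵒᵖ V V' F)
    (LinearMap.restrictScalars_injective F)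

theorem isUnit_gammaAlgebra [Module.Finite F V] (Γ : Module.End Dᵐᵒᵖ V) {r : ℝ}
    (hblock : IsSingleBlock F Γ r) :
    IsUnit (⟨Γ, Algebra.subset_adjoin (Set.mem_insert _ _)⟩ : gammaAlgebra F Γ) := by
  have hcomm : IsMulCommutative (gammaAlgebra F Γ) := by
    refine Algebra.isMulCommutative_adjoin F ?_
    rintro x (rfl | hx) y (rfl | hy)
    · rfl
    · exact ((Set.mem_center_iff.1 hy).comm x).symm
    · exact (Set.mem_center_iff.1 hx).comm y
    · exact (Set.mem_center_iff.1 hx).comm y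
  have := finite_linearMap (F := F) (D := D) (V := V) (V' := V)
  have : Module.Finite F (gammaAlgebra F Γ) :=
    Module.Finite.of_injective (gammaAlgebra F Γ).val.toLinearMap Subtype.val_injective
  let : CommRing (gammaAlgebra F Γ) :=
    { (inferInstance : Ring (gammaAlgebra F Γ)) with mul_comm := hcomm.is_comm.comm }
  refine isUnit_of_forall_algHom_ne_zero (K := F) _ fun f hf => ?_
  have := hblock f
  rw [hf, algVal, if_pos rfl] at this
  exact WithTop.top_ne_coe this

theorem homLattice_gamma [IsUltrametricDist F] [CompleteSpace F] [Module.Finite F V]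
    {Γ : Module.End Dᵐᵒᵖ V} {r : ℝ} (hblock : IsSingleBlock F Γ r) {L : ℝ → AddSubgroup V}
    (hLΓ : IsGammaLatticeFunction F Γ L) : Γ ∈ homLattice L L (-r) :=
  hLΓ ⟨Γ, Algebra.subset_adjoin (Set.mem_insert _ _)⟩ (-r) fun f => (hblock f).ge

/-- The inverse is taken inside `F'[Γ]`, where all its components have valuation `r`; this is what
lets the hypothesis on `L` apply to it. -/
theorem exists_inverse_gamma [IsUltrametricDist F] [CompleteSpace F] [Module.Finite F V]
    {Γ : Module.End Dᵐᵒᵖ V} {r : ℝ} (hblock : IsSingleBlock F Γ r) {L : ℝ → AddSubgroup V}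
    (hLΓ : IsGammaLatticeFunction F Γ L) :
    ∃ Δ ∈ homLattice L L r, Γ * Δ = 1 ∧ Δ * Γ = 1 := by
  obtain ⟨u, hu⟩ := isUnit_gammaAlgebra Γ hblock
  have h1 : Γ * ((u⁻¹ : (gammaAlgebra F Γ)ˣ) : gammaAlgebra F Γ) = 1 := by
    have := congrArg Subtype.val u.mul_inv
    rwa [hu] at this
  have h2 : ((u⁻¹ : (gammaAlgebra F Γ)ˣ) : gammaAlgebra F Γ) * Γ = 1 := by
    have := congrArg Subtype.val u.inv_mul
    rwa [hu] at this
  refine ⟨_, hLΓ _ r fun f => ?_, h1, h2⟩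
  have hf := hblock f
  rw [← hu] at hf
  have h0 : f u ≠ 0 := (u.isUnit.map f).ne_zero
  have h3 : f ((u⁻¹ : (gammaAlgebra F Γ)ˣ) : gammaAlgebra F Γ) = (f u)⁻¹ :=
    eq_inv_of_mul_eq_one_left (by rw [← map_mul, u.inv_mul, map_one])
  rw [h3, algVal_inv F h0 hf, neg_neg]

end GammaUnit

/-! ### Adjoints -/

section Adjoints

variable {D : Type*} [DivisionRing D] {τ : D → D} {ε ε' ε'' : ℤˣ}
  {V : Type*} [AddCommGroup V] [Module Dᵐᵒᵖ V] [Module.Finite Dᵐᵒᵖ V]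
  {V' : Type*} [AddCommGroup V'] [Module Dᵐᵒᵖ V']
  {V'' : Type*} [AddCommGroup V''] [Module Dᵐᵒᵖ V'']

theorem adj_eq_of_forall {h : HermForm τ ε V} {h' : HermForm τ ε' V'} {w : V →ₗ[Dᵐᵒᵖ] V'}
    {z : V' →ₗ[Dᵐᵒᵖ] V} (hz : ∀ v v', h'.form (w v) v' = h.form v (z v')) :
    adj h h' w = z := by
  ext v'
  exact h.ext_right fun v => by rw [← adj_spec, hz]

theorem adj_add (h : HermForm τ ε V) (h' : HermForm τ ε' V') (w z : V →ₗ[Dᵐᵒᵖ] V') :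
    adj h h' (w + z) = adj h h' w + adj h h' z :=
  adj_eq_of_forall fun v v' => by
    simp only [LinearMap.add_apply, h.add_right, h'.add_left, adj_spec h h']

theorem adj_neg (h : HermForm τ ε V) (h' : HermForm τ ε' V') (w : V →ₗ[Dᵐᵒᵖ] V') :
    adj h h' (-w) = -adj h h' w := by
  rw [eq_neg_iff_add_eq_zero, ← adj_add, neg_add_cancel]
  exact adj_eq_of_forall fun v v' => by simp [h.form_zero_right, h'.form_zero_left]

theorem adj_sub (h : HermForm τ ε V) (h' : HermForm τ ε' V') (w z : V →ₗ[Dᵐᵒᵖ] V') :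
    adj h h' (w - z) = adj h h' w - adj h h' z := by
  rw [sub_eq_add_neg, adj_add, adj_neg, sub_eq_add_neg]

theorem adj_comp [Module.Finite Dᵐᵒᵖ V'] (h : HermForm τ ε V) (h' : HermForm τ ε' V')
    (h'' : HermForm τ ε'' V'') (w : V →ₗ[Dᵐᵒᵖ] V') (z : V' →ₗ[Dᵐᵒᵖ] V'') :
    adj h h'' (z ∘ₗ w) = adj h h' w ∘ₗ adj h' h'' z :=
  adj_eq_of_forall fun v v' => by
    rw [LinearMap.comp_apply, LinearMap.comp_apply, adj_spec h' h'', adj_spec h h']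

/-- For forms of opposite signs, the roles of the two arguments can be exchanged. -/
theorem form_adj_left (h : HermForm τ ε V) (h' : HermForm τ (-ε) V') (w : V →ₗ[Dᵐᵒᵖ] V')
    (v' : V') (v : V) : h.form (adj h h' w v') v = -h'.form v' (w v) := by
  rw [h.herm, h'.herm, adj_spec h h']
  simp

/-- The sign comes from the opposite symmetries of the two forms; it is the reason why `w⋆w` is
skew. -/
theorem adj_adj [Module.Finite Dᵐᵒᵖ V'] (h : HermForm τ ε V) (h' : HermForm τ (-ε) V')
    (w : V →ₗ[Dᵐᵒᵖ] V') : adj h' h (adj h h' w) = -w :=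
  adj_eq_of_forall fun v' v => by
    rw [form_adj_left, LinearMap.neg_apply, h'.form_neg_right]

theorem mem_lieU {h : HermForm τ ε V} {X : Module.End Dᵐᵒᵖ V} :
    X ∈ lieU h ↔ adj h h X = -X := by
  rw [eq_neg_iff_add_eq_zero, add_comm]
  rfl

theorem sub_mem_lieU {h : HermForm τ ε V} {X Y : Module.End Dᵐᵒᵖ V} (hX : X ∈ lieU h)
    (hY : Y ∈ lieU h) : X - Y ∈ lieU h := by
  rw [mem_lieU] at *
  rw [adj_sub, hX, hY]
  abel

theorem momentMap_mem_lieU [Module.Finite Dᵐᵒᵖ V'] (h : HermForm τ ε V)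
    (h' : HermForm τ (-ε) V') (w : V →ₗ[Dᵐᵒᵖ] V') : momentMap h h' w ∈ lieU h := by
  rw [mem_lieU, momentMap, adj_comp h h' h, adj_adj, LinearMap.comp_neg]

theorem momentMap_add_sub (h : HermForm τ ε V) (h' : HermForm τ ε' V')
    (w b : V →ₗ[Dᵐᵒᵖ] V') :
    momentMap h h' (w + b) - momentMap h h' w =
      adj h h' w ∘ₗ b + adj h h' b ∘ₗ w + adj h h' b ∘ₗ b := by
  simp only [momentMap, adj_add, LinearMap.add_comp, LinearMap.comp_add]
  abel

theorem form_momentMap (h : HermForm τ ε V) (h' : HermForm τ ε' V')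
    (w : V →ₗ[Dᵐᵒᵖ] V') (x y : V) :
    h'.form (w x) (w y) = h.form x (momentMap h h' w y) :=
  adj_spec h h' w x (w y)

theorem momentMap_eq_of_forall {h : HermForm τ ε V} {h' : HermForm τ ε' V'}
    {w : V →ₗ[Dᵐᵒᵖ] V'} {Y : Module.End Dᵐᵒᵖ V}
    (hY : ∀ x y, h'.form (w x) (w y) = h.form x (Y y)) : momentMap h h' w = Y := by
  ext y
  exact h.ext_right fun x => by rw [← hY, form_momentMap h h']

theorem mem_unitarySet_of_forall {h : HermForm τ ε V} {g : Module.End Dᵐᵒᵖ V}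
    (hg : ∀ x y, h.form (g x) (g y) = h.form x y) : g ∈ unitarySet h := by
  have : adj h h g * g = 1 := momentMap_eq_of_forall (Y := 1) hg
  exact mul_eq_one_symm this

theorem form_of_mem_unitarySet {h : HermForm τ ε V} {g : Module.End Dᵐᵒᵖ V}
    (hg : g ∈ unitarySet h) (x y : V) : h.form (g x) (g y) = h.form x y := by
  have : adj h h g * g = 1 := mul_eq_one_symm hg
  rw [form_momentMap h h, momentMap]
  exact congrArg (h.form x) (LinearMap.congr_fun this y)

end Adjoints

/-! ### Lattice functions -/

section LatticeFunctions

variable {F : Type*} [NontriviallyNormedField F] {D : Type*} [DivisionRing D] [Algebra F D]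
  {τ : D → D} {ε ε' : ℤˣ}
  {V : Type*} [AddCommGroup V] [Module Dᵐᵒᵖ V]
  {V' : Type*} [AddCommGroup V'] [Module Dᵐᵒᵖ V']
  {L : ℝ → AddSubgroup V} {L' : ℝ → AddSubgroup V'}

theorem IsLatticeFunction.antitone (hL : IsLatticeFunction F (D := D) L) : Antitone L := by
  intro t u htu
  rcases htu.eq_or_lt with rfl | h
  · exact le_rfl
  · exact hL.anti t u h

theorem IsLatticeFunction.op_smul_mem (hL : IsLatticeFunction F (D := D) L) {a : D} {v t : ℝ}
    (ha : divVal F a = (v : WithTop ℝ)) {x : V} (hx : x ∈ L t) : op a • x ∈ L (t + v) := by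
  have : op a • x ∈ (L (t + v) : Set V) := by
    rw [hL.smul t v a ha]
    exact ⟨x, hx, rfl⟩
  exact this

theorem IsLatticeFunction.op_smul_mem_of_nonneg (hL : IsLatticeFunction F (D := D) L) {a : D}
    {t : ℝ} (ha : 0 ≤ divVal F a) {x : V} (hx : x ∈ L t) : op a • x ∈ L t := by
  rcases eq_or_ne a 0 with rfl | h0
  · simp
  · obtain ⟨v, hv⟩ := exists_divVal_eq F h0
    refine hL.antitone ?_ (hL.op_smul_mem hv hx)
    rw [hv] at ha
    have : 0 ≤ v := by exact_mod_cast ha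
    linarith

theorem IsLatticeFunction.exhaustive (hL : IsLatticeFunction F (D := D) L) (x : V) :
    ∃ t, x ∈ L t := by
  obtain ⟨S, hS, hL0⟩ := hL.isLattice 0
  have hx : x ∈ Submodule.span Dᵐᵒᵖ (S : Set V) := by rw [hS]; trivial
  induction hx using Submodule.span_induction with
  | mem x hx =>
    refine ⟨0, ?_⟩
    rw [hL0]
    exact AddSubgroup.subset_closure ⟨x, hx, 1, by rw [divVal_one], by simp⟩
  | zero => exact ⟨0, zero_mem _⟩
  | add x y _ _ hx hy =>
    obtain ⟨t, ht⟩ := hx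
    obtain ⟨u, hu⟩ := hy
    exact ⟨min t u, add_mem (hL.antitone (min_le_left _ _) ht)
      (hL.antitone (min_le_right _ _) hu)⟩
  | smul a x _ hx =>
    obtain ⟨t, ht⟩ := hx
    induction a using MulOpposite.rec' with
    | h a =>
      rcases eq_or_ne a 0 with rfl | h0
      · exact ⟨0, by simp⟩
      · obtain ⟨v, hv⟩ := exists_divVal_eq F h0
        exact ⟨_, hL.op_smul_mem hv ht⟩

/-- A linear map sends a lattice into some member of a lattice function. -/
theorem IsLatticeFunction.exists_map_le (hL : IsLatticeFunction F (D := D) L)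
    (hL' : IsLatticeFunction F (D := D) L') (w : V →ₗ[Dᵐᵒᵖ] V') :
    ∃ t, ∀ x ∈ L 0, w x ∈ L' t := by
  obtain ⟨S, -, hL0⟩ := hL.isLattice 0
  have hS : ∃ t, ∀ v ∈ S, w v ∈ L' t := by
    clear hL0
    induction S using Finset.cons_induction with
    | empty => exact ⟨0, by simp⟩
    | cons v S _ ih =>
      obtain ⟨t, ht⟩ := ih
      obtain ⟨u, hu⟩ := hL'.exhaustive (w v)
      refine ⟨min t u, fun x hx => ?_⟩
      rcases Finset.mem_cons.1 hx with rfl | hx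
      · exact hL'.antitone (min_le_right _ _) hu
      · exact hL'.antitone (min_le_left _ _) (ht x hx)
  obtain ⟨t, ht⟩ := hS
  refine ⟨t, fun x hx => ?_⟩
  rw [hL0] at hx
  induction hx using AddSubgroup.closure_induction with
  | mem x hx =>
    obtain ⟨v, hv, a, ha, rfl⟩ := hx
    rw [map_smul]
    exact hL'.op_smul_mem_of_nonneg ha (ht v hv)
  | zero => rw [map_zero]; exact zero_mem _
  | add x y _ _ hx hy => rw [map_add]; exact add_mem hx hy
  | neg x _ hx => rw [map_neg]; exact neg_mem hx

/-- Every linear map between spaces with lattice functions lies in some step of the filtration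
`homLattice`. -/
theorem IsLatticeFunction.exists_mem_homLattice [IsUltrametricDist F] [LocallyCompactSpace F]
    (hD : Module.finrank F D ≠ 0) (hL : IsLatticeFunction F (D := D) L)
    (hL' : IsLatticeFunction F (D := D) L') (w : V →ₗ[Dᵐᵒᵖ] V') :
    ∃ t, w ∈ homLattice L L' t := by
  obtain ⟨t, ht⟩ := hL.exists_map_le hL' w
  obtain ⟨ϖ, h0, h1⟩ := NormedField.exists_norm_lt_one F
  set c := Real.logb (uniformizerNorm F) ‖ϖ‖ with hc
  have hc0 : 0 < c := Real.logb_pos_of_base_lt_one (uniformizerNorm_pos F)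
    (uniformizerNorm_lt_one F) h0 h1
  -- Scaling by powers of `ϖ` reduces to index 0; rounding `u` down to a multiple of `c` loses at
  -- most `c`.
  refine ⟨t - c, fun u x hx => ?_⟩
  have hval : divVal F (algebraMap F D (ϖ ^ ⌊u / c⌋)) = ((⌊u / c⌋ * c : ℝ) : WithTop ℝ) := by
    rw [divVal_algebraMap F hD (zpow_ne_zero _ (norm_pos_iff.1 h0)), norm_zpow,
      Real.logb, Real.log_zpow, mul_div_assoc, ← Real.logb]
  have hx' : x ∈ (L (0 + ⌊u / c⌋ * c) : Set V) := by
    refine hL.antitone ?_ hx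
    rw [zero_add, ← le_div_iff₀ hc0]
    exact Int.floor_le _
  rw [hL.smul _ _ _ hval] at hx'
  obtain ⟨y, hy, rfl⟩ := hx'
  rw [map_smul]
  refine hL'.antitone ?_ (hL'.op_smul_mem hval (ht y hy))
  have := (div_lt_iff₀ hc0).1 (Int.lt_floor_add_one (u / c))
  linarith

/-- The shifted image of a lattice function under a linear equivalence. -/
theorem IsLatticeFunction.map_shift (hL : IsLatticeFunction F (D := D) L)
    {w : V →ₗ[Dᵐᵒᵖ] V'} (hw : Function.Bijective w) (s : ℝ) :
    IsLatticeFunction F (D := D) fun u => (L (u + s)).map w.toAddMonoidHom where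
  isLattice t := by
    classical
    obtain ⟨S, hS, hLS⟩ := hL.isLattice (t + s)
    refine ⟨S.image w, ?_, ?_⟩
    · rw [Finset.coe_image, Submodule.span_image, hS, Submodule.map_top,
        LinearMap.range_eq_top.2 hw.surjective]
    · rw [hLS, AddMonoidHom.map_closure]
      congr 1
      ext y
      constructor
      · rintro ⟨_, ⟨v, hv, a, ha, rfl⟩, rfl⟩
        exact ⟨w v, Finset.mem_image_of_mem _ hv, a, ha, map_smul w _ _⟩
      · rintro ⟨_, hv, a, ha, rfl⟩
        obtain ⟨v, hv', rfl⟩ := Finset.mem_image.1 hv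
        exact ⟨op a • v, ⟨v, hv', a, ha, rfl⟩, map_smul w _ _⟩
  anti t u htu := AddSubgroup.map_mono (hL.anti _ _ (by linarith))
  smul t v a ha := by
    have := hL.smul (t + s) v a ha
    rw [AddSubgroup.coe_map, AddSubgroup.coe_map, add_right_comm, this, Set.image_image,
      Set.image_image]
    exact Set.image_congr fun x _ => map_smul w (op a) x
  left_cont t := by
    ext y
    obtain ⟨x, rfl⟩ := hw.surjective y
    have hmem : ∀ u, w x ∈ ((L (u + s)).map w.toAddMonoidHom : Set V') ↔ x ∈ (L (u + s) : Set V) :=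
      fun u => hw.injective.mem_set_image
    simp only [Set.mem_iInter, hmem]
    rw [hL.left_cont]
    simp only [Set.mem_iInter]
    exact ⟨fun H u hu => H (u + s) (by linarith), fun H u hu => by
      simpa using H (u - s) (by linarith)⟩

/-- By duality, a vector in all the lattices pairs into `𝔭_D` with all of `V`. A nonzero pairing
could be rescaled to 1, which is not in `𝔭_D`. -/
theorem IsSelfDualLatticeFunction.separated {h : HermForm τ ε V} (hτ : τ 0 = 0)
    (hL : IsSelfDualLatticeFunction F h L) (x : V) (hx : ∀ t, x ∈ L t) : x = 0 := by
  have hform : ∀ y, 0 < divVal F (h.form x y) := by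
    intro y
    obtain ⟨t, ht⟩ := hL.isLatticeFunction.exhaustive y
    have : x ∈ {v : V | ∀ x ∈ L t, 0 < divVal F (h.form v x)} := by
      rw [hL.self_dual t]
      exact Set.mem_iUnion₂.2 ⟨-t + 1, by simp, hx _⟩
    exact this y ht
  refine h.nondeg x fun y => ?_
  rw [h.herm]
  suffices h.form x y = 0 by rw [this, hτ, mul_zero]
  by_contra h0
  have := hform (op (h.form x y)⁻¹ • y)
  rw [h.smul_right, mul_inv_cancel₀ h0, divVal_one] at this
  exact lt_irrefl _ this

/-- Self-duality describes only the lattices at `c⁺`; left continuity turns it into a test for `L c`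
itself. -/
theorem IsSelfDualLatticeFunction.mem_iff {h : HermForm τ ε V}
    (hL : IsSelfDualLatticeFunction F h L) {c : ℝ} {v : V} :
    v ∈ L c ↔ ∀ t > -c, ∀ x ∈ L t, 0 < divVal F (h.form v x) := by
  constructor
  · intro hv t ht
    have : v ∈ {v : V | ∀ x ∈ L t, 0 < divVal F (h.form v x)} := by
      rw [hL.self_dual t]
      exact Set.mem_iUnion₂.2 ⟨c, by simpa using neg_lt.1 ht, hv⟩
    exact this
  · intro hv
    have : v ∈ (L c : Set V) := by
      rw [hL.isLatticeFunction.left_cont c]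
      refine Set.mem_iInter₂.2 fun u hu => ?_
      have h1 : v ∈ {v : V | ∀ x ∈ L (-u), 0 < divVal F (h.form v x)} :=
        hv (-u) (neg_lt_neg hu)
      rw [hL.self_dual (-u)] at h1
      obtain ⟨u', hu', hv'⟩ := Set.mem_iUnion₂.1 h1
      rw [neg_neg] at hu'
      exact hL.isLatticeFunction.antitone (le_of_lt hu') hv'
    exact this

theorem adj_mem_homLattice [Module.Finite Dᵐᵒᵖ V] {h : HermForm τ ε V} {h' : HermForm τ (-ε) V'}
    (hL : IsSelfDualLatticeFunction F h L) (hL' : IsSelfDualLatticeFunction F h' L')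
    {w : V →ₗ[Dᵐᵒᵖ] V'} {t : ℝ} (hw : w ∈ homLattice L L' t) :
    adj h h' w ∈ homLattice L' L t := by
  intro u v' hv'
  refine hL.mem_iff.2 fun c hc x hx => ?_
  rw [form_adj_left, divVal_neg]
  exact hL'.mem_iff.1 hv' (c + t) (by linarith) _ (hw c x hx)

end LatticeFunctions

/-! ### The lattices of homomorphisms -/

section HomLattices

variable {D : Type*} [DivisionRing D]
  {V : Type*} [AddCommGroup V] [Module Dᵐᵒᵖ V]
  {V' : Type*} [AddCommGroup V'] [Module Dᵐᵒᵖ V']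
  {V'' : Type*} [AddCommGroup V''] [Module Dᵐᵒᵖ V'']
  {L : ℝ → AddSubgroup V} {L' : ℝ → AddSubgroup V'} {L'' : ℝ → AddSubgroup V''}

theorem add_mem_homLattice {t : ℝ} {w z : V →ₗ[Dᵐᵒᵖ] V'} (hw : w ∈ homLattice L L' t)
    (hz : z ∈ homLattice L L' t) : w + z ∈ homLattice L L' t :=
  fun u v hv => add_mem (hw u v hv) (hz u v hv)

theorem neg_mem_homLattice {t : ℝ} {w : V →ₗ[Dᵐᵒᵖ] V'} (hw : w ∈ homLattice L L' t) :
    -w ∈ homLattice L L' t :=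
  fun u v hv => neg_mem (hw u v hv)

theorem sub_mem_homLattice {t : ℝ} {w z : V →ₗ[Dᵐᵒᵖ] V'} (hw : w ∈ homLattice L L' t)
    (hz : z ∈ homLattice L L' t) : w - z ∈ homLattice L L' t :=
  fun u v hv => sub_mem (hw u v hv) (hz u v hv)

variable (D L L') in
/-- `homLattice L L' t` as an additive subgroup. -/
def homSubgroup (t : ℝ) : AddSubgroup (V →ₗ[Dᵐᵒᵖ] V') where
  carrier := homLattice L L' t
  zero_mem' _ _ _ := zero_mem _
  add_mem' := add_mem_homLattice
  neg_mem' := neg_mem_homLattice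

theorem comp_mem_homLattice {t u v : ℝ} {w : V →ₗ[Dᵐᵒᵖ] V'} {z : V' →ₗ[Dᵐᵒᵖ] V''}
    (hz : z ∈ homLattice L' L'' u) (hw : w ∈ homLattice L L' t) (hv : t + u = v) :
    z ∘ₗ w ∈ homLattice L L'' v := by
  intro c x hx
  have := hz _ _ (hw c x hx)
  rwa [add_assoc, hv] at this

theorem homLattice_mono (hL' : Antitone L') {t u : ℝ} (htu : t ≤ u) {w : V →ₗ[Dᵐᵒᵖ] V'}
    (hw : w ∈ homLattice L L' u) : w ∈ homLattice L L' t :=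
  fun c x hx => hL' (by linarith) (hw c x hx)

variable {F : Type*} [NontriviallyNormedField F]

theorem algebraMap_op_smul [Algebra F D] [Module F V] [IsScalarTower F Dᵐᵒᵖ V] (a : F)
    (x : V) : op (algebraMap F D a) • x = a • x := by
  rw [← MulOpposite.algebraMap_apply, algebraMap_smul]

theorem IsSelfDualLatticeFunction.isValuedFiltration [Algebra F D] [Module F V]
    [IsScalarTower F Dᵐᵒᵖ V] {τ : D → D} {ε : ℤˣ} (hD : Module.finrank F D ≠ 0)
    (hτ : τ 0 = 0) {h : HermForm τ ε V} (hL : IsSelfDualLatticeFunction F h L) :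
    IsValuedFiltration F L where
  anti := hL.isLatticeFunction.antitone
  smul_mem a ha t x hx := by
    rw [← algebraMap_op_smul (D := D)]
    exact hL.isLatticeFunction.op_smul_mem (divVal_algebraMap F hD ha) hx
  exhaustive := hL.isLatticeFunction.exhaustive
  separated := hL.separated hτ

theorem isValuedFiltration_homSubgroup [IsUltrametricDist F] [LocallyCompactSpace F]
    [Algebra F D] [Module F V'] [IsScalarTower F Dᵐᵒᵖ V']
    (hD : Module.finrank F D ≠ 0) (hL : IsLatticeFunction F (D := D) L)
    (hL' : IsLatticeFunction F (D := D) L') (hLF : IsValuedFiltration F L') :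
    IsValuedFiltration F (homSubgroup D L L') where
  anti _ _ htu _ hw := homLattice_mono hLF.anti htu hw
  smul_mem a ha t w hw u x hx := by
    rw [LinearMap.smul_apply, ← add_assoc]
    exact hLF.smul_mem a ha _ _ (hw u x hx)
  exhaustive := hL.exists_mem_homLattice hD hL'
  separated w hw := by
    ext x
    obtain ⟨t, ht⟩ := hL.exhaustive x
    refine hLF.separated _ fun u => ?_
    have := hw (u - t) t x ht
    rwa [add_sub_cancel] at this

/-- Perturbations of the identity by a topologically nilpotent endomorphism are surjective on
each lattice. -/
theorem exists_add_apply_eq [IsUltrametricDist F] [LocallyCompactSpace F]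
    [Module F V] [Module.Finite F V] (hLF : IsValuedFiltration F L) {N : Module.End Dᵐᵒᵖ V}
    {δ : ℝ} (hδ : 0 < δ) (hN : N ∈ homLattice L L δ) {u : ℝ} {x : V} (hx : x ∈ L u) :
    ∃ y ∈ L u, y + N y = x := by
  -- The equation `y = x - N y` gains `δ` at each iteration.
  obtain ⟨y, hy, h⟩ := hLF.exists_fixedPoint (fun y => x - N y) hδ
    (fun y hy => sub_mem hx (hLF.anti (by linarith) (hN u y hy)))
    (fun y _ z _ u hyz => by
      have := neg_mem (hN u _ hyz)
      rw [map_sub] at this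
      convert this using 1
      abel)
  exact ⟨y, hy, by rw [← eq_sub_iff_add_eq]; exact h.symm⟩

end HomLattices

/-! ### The moment map on lattices of homomorphisms -/

section MomentMap

variable {D : Type*} [DivisionRing D]
  {V : Type*} [AddCommGroup V] [Module Dᵐᵒᵖ V] {L : ℝ → AddSubgroup V}

/-- `Y` maps the lattice `L u` onto `L (u - r)` for all `u`. -/
structure ShiftsLattices (L : ℝ → AddSubgroup V) (Y : Module.End Dᵐᵒᵖ V) (r : ℝ) : Prop where
  mem : Y ∈ homLattice L L (-r)
  exists_preimage : ∀ u, ∀ x ∈ L u, ∃ y ∈ L (u + r), Y y = x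

/-- Write `Y = Γ (1 + N)` with `N = Δ (Y - Γ)`. Since `N` raises indices by `c + r > 0`, solving `(1
+ N) y = Δ x` gives a preimage of `x` in the right lattice. -/
theorem ShiftsLattices.perturb {F : Type*} [NontriviallyNormedField F] [IsUltrametricDist F]
    [LocallyCompactSpace F] [Module F V] [Module.Finite F V] (hLF : IsValuedFiltration F L)
    {Γ Δ Y : Module.End Dᵐᵒᵖ V} {r c : ℝ}
    (hΓ : Γ ∈ homLattice L L (-r)) (hΔ : Δ ∈ homLattice L L r) (h : Γ * Δ = 1) (hc : -r < c)
    (hY : Y - Γ ∈ homLattice L L c) : ShiftsLattices L Y r := by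
  constructor
  · have := add_mem_homLattice (homLattice_mono hLF.anti hc.le hY) hΓ
    rwa [sub_add_cancel] at this
  · intro u x hx
    have hN : Δ * (Y - Γ) ∈ homLattice L L (c + r) := comp_mem_homLattice hΔ hY rfl
    obtain ⟨y, hy, hyx⟩ := exists_add_apply_eq hLF (by linarith) hN (hΔ u x hx)
    refine ⟨y, hy, ?_⟩
    have h1 : ∀ z, Γ (Δ z) = z := LinearMap.congr_fun h
    have := congrArg Γ hyx
    rw [map_add, Module.End.mul_apply, h1, h1] at this
    simpa using this

theorem ShiftsLattices.bijective [Module.Finite Dᵐᵒᵖ V] {Y : Module.End Dᵐᵒᵖ V} {r : ℝ}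
    (hY : ShiftsLattices L Y r) (hL : ∀ x, ∃ t, x ∈ L t) : Function.Bijective Y := by
  have hs : Function.Surjective Y := fun x => by
    obtain ⟨t, ht⟩ := hL x
    obtain ⟨y, -, hy⟩ := hY.exists_preimage t x ht
    exact ⟨y, hy⟩
  exact ⟨LinearMap.injective_iff_surjective.2 hs, hs⟩

theorem ShiftsLattices.exists_rightInverse [Module.Finite Dᵐᵒᵖ V] {Y : Module.End Dᵐᵒᵖ V} {r : ℝ}
    (hY : ShiftsLattices L Y r) (hL : ∀ x, ∃ t, x ∈ L t) :
    ∃ Z ∈ homLattice L L r, Y * Z = 1 := by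
  let e := LinearEquiv.ofBijective Y (hY.bijective hL)
  refine ⟨e.symm, fun u x hx => ?_, LinearMap.ext e.apply_symm_apply⟩
  obtain ⟨y, hy, rfl⟩ := hY.exists_preimage u x hx
  have : e.symm (Y y) = y := e.symm_apply_apply y
  simpa [this] using hy

variable {F : Type*} [NontriviallyNormedField F] [Algebra F D] {τ : D → D} {ε : ℤˣ}
  [Module.Finite Dᵐᵒᵖ V] {V' : Type*} [AddCommGroup V'] [Module Dᵐᵒᵖ V']
  {h : HermForm τ ε V} {h' : HermForm τ (-ε) V'} {L' : ℝ → AddSubgroup V'}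

/-- Pairing `w x` with `w (L (t + s))` is pairing `x` with `M(w) (L (t + s)) = L (t - s)`, so the
claim reduces to self-duality of `L` at `t - s`. -/
theorem IsSelfDualLatticeFunction.map_shift (hL : IsSelfDualLatticeFunction F h L)
    {w : V →ₗ[Dᵐᵒᵖ] V'} (hw : Function.Bijective w) {r s : ℝ} (hrs : r = s + s)
    (hY : ShiftsLattices L (momentMap h h' w) r) :
    IsSelfDualLatticeFunction F h' fun u => (L (u + s)).map w.toAddMonoidHom where
  isLatticeFunction := hL.isLatticeFunction.map_shift hw s
  self_dual t := by
    ext y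
    obtain ⟨x, rfl⟩ := hw.surjective y
    have hmem : ∀ u, w x ∈ ((L (u + s)).map w.toAddMonoidHom : Set V') ↔ x ∈ (L (u + s) : Set V) :=
      fun u => hw.injective.mem_set_image
    simp only [Set.mem_iUnion, hmem]
    have h1 : (w x ∈ {v : V' | ∀ y ∈ (L (t + s)).map w.toAddMonoidHom,
        0 < divVal F (h'.form v y)}) ↔ x ∈ {v : V | ∀ y ∈ L (t - s), 0 < divVal F (h.form v y)} := by
      constructor
      · intro H y hy
        obtain ⟨z, hz, rfl⟩ := hY.exists_preimage _ y hy
        rw [← form_momentMap h h']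
        rw [hrs, ← add_assoc, sub_add_cancel] at hz
        exact H (w z) ⟨z, hz, rfl⟩
      · rintro H _ ⟨y, hy, rfl⟩
        have := H _ (by
          have := hY.mem _ y hy
          convert this using 2
          linarith)
        rwa [← form_momentMap h h'] at this
    rw [h1, hL.self_dual]
    simp only [Set.mem_iUnion]
    exact ⟨fun ⟨u, hu, H⟩ => ⟨u - s, by linarith [hu.lt], by simpa using H⟩,
      fun ⟨u, hu, H⟩ => ⟨u + s, by linarith [hu.lt], H⟩⟩

variable [Module.Finite Dᵐᵒᵖ V']

/-- The linear terms `w⋆b` and `b⋆w` have index `-s + t`; the quadratic term has index `2t`, which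
is no smaller since `-s ≤ t`. -/
theorem momentMap_add_sub_mem (hL : IsSelfDualLatticeFunction F h L)
    (hL' : IsSelfDualLatticeFunction F h' L') {s t : ℝ} (hst : -s ≤ t)
    {w b : V →ₗ[Dᵐᵒᵖ] V'} (hw : w ∈ homLattice L L' (-s)) (hb : b ∈ homLattice L L' t) :
    momentMap h h' (w + b) - momentMap h h' w ∈ lieFiltration h L (-s + t) := by
  refine ⟨sub_mem_lieU (momentMap_mem_lieU h h' _) (momentMap_mem_lieU h h' _), ?_⟩
  have hw' := adj_mem_homLattice hL hL' hw
  have hb' := adj_mem_homLattice hL hL' hb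
  rw [momentMap_add_sub]
  exact add_mem_homLattice
    (add_mem_homLattice (comp_mem_homLattice hw' hb (add_comm _ _)) (comp_mem_homLattice hb' hw rfl))
    (homLattice_mono hL.isLatticeFunction.antitone (by linarith)
      (comp_mem_homLattice hb' hb rfl))

/-- If `w` is mapped by the moment map to an automorphism shifting the lattices, then the moment
map sends `w + B_t` onto `M(w) + 𝔤_{x, -s + t}`. -/
theorem exists_momentMap_add_eq [IsUltrametricDist F] [LocallyCompactSpace F] [CharZero F]
    (hp : ‖(2 : F)‖ = 1) (hD : Module.finrank F D ≠ 0) (hτ : τ 0 = 0)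
    [Module F V] [IsScalarTower F Dᵐᵒᵖ V] [Module.Finite F V]
    [Module F V'] [IsScalarTower F Dᵐᵒᵖ V'] [Module.Finite F V']
    (hL : IsSelfDualLatticeFunction F h L) (hL' : IsSelfDualLatticeFunction F h' L')
    {r s t : ℝ} (hrs : r = s + s) (hst : -s < t)
    {w : V →ₗ[Dᵐᵒᵖ] V'} (hw : w ∈ homLattice L L' (-s))
    (hY : ShiftsLattices L (momentMap h h' w) r) {X : Module.End Dᵐᵒᵖ V}
    (hX : X ∈ lieFiltration h L (-s + t)) :
    ∃ b ∈ homLattice L L' t, momentMap h h' (w + b) = momentMap h h' w + X := by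
  have hLF := hL.isValuedFiltration hD hτ
  have hLF' := hL'.isValuedFiltration hD hτ
  have hH := isValuedFiltration_homSubgroup hD hL.isLatticeFunction hL'.isLatticeFunction hLF'
  have := finite_linearMap (F := F) (D := D) (V := V) (V' := V')
  obtain ⟨Z, hZ, hYZ⟩ := hY.exists_rightInverse hLF.exhaustive
  have hR : w ∘ₗ Z ∈ homLattice L L' s := comp_mem_homLattice hw hZ (by linarith)
  have hhalf : ∀ u, ∀ b : V →ₗ[Dᵐᵒᵖ] V',
      b ∈ homLattice L L' u → (2 : F)⁻¹ • b ∈ homLattice L L' u := by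
    intro u b hb
    have := hH.smul_mem (2 : F)⁻¹ (by simp) u b hb
    rwa [norm_inv, hp, inv_one, Real.logb_one, add_zero] at this
  -- Fixed points satisfy `b = ½ w Z (X - b⋆b)`. As `w Z` has index `s` and `b`, `c` have index `t`,
  -- differences gain `s + t > 0`.
  obtain ⟨b, hb, hTb⟩ := hH.exists_fixedPoint
    (fun b => (2 : F)⁻¹ • ((w ∘ₗ Z) ∘ₗ (X - adj h h' b ∘ₗ b))) (t₀ := t) (δ := s + t)
    (by linarith)
    (fun b hb => by
      have h1 : X - adj h h' b ∘ₗ b ∈ homLattice L L (-s + t) :=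
        sub_mem_homLattice hX.2
          (homLattice_mono hLF.anti (by linarith)
            (comp_mem_homLattice (adj_mem_homLattice hL hL' hb) hb rfl))
      exact hhalf _ _ (comp_mem_homLattice hR h1 (by ring)))
    (fun b hb c hc u hbc => by
      have h1 : (X - adj h h' b ∘ₗ b) - (X - adj h h' c ∘ₗ c) =
          -(adj h h' b ∘ₗ (b - c) + adj h h' (b - c) ∘ₗ c) := by
        rw [adj_sub, LinearMap.sub_comp, LinearMap.comp_sub]
        abel
      have h2 : (X - adj h h' b ∘ₗ b) - (X - adj h h' c ∘ₗ c) ∈ homLattice L L (u + t) := by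
        rw [h1]
        exact neg_mem_homLattice (add_mem_homLattice
          (comp_mem_homLattice (adj_mem_homLattice hL hL' hb) hbc rfl)
          (comp_mem_homLattice (adj_mem_homLattice hL hL' hbc) hc (add_comm _ _)))
      rw [← smul_sub, ← LinearMap.comp_sub]
      exact hhalf _ _ (comp_mem_homLattice hR h2 (by ring)))
  refine ⟨b, hb, ?_⟩
  set Q := X - adj h h' b ∘ₗ b with hQ
  have hQU : adj h h Q = -Q := by
    rw [← mem_lieU]
    exact sub_mem_lieU hX.1 (momentMap_mem_lieU h h' b)
  have h2 : adj h h' w ∘ₗ b + adj h h' w ∘ₗ b = Q := by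
    have h3 : b + b = (w ∘ₗ Z) ∘ₗ Q := by
      rw [← two_smul F b, ← hTb, smul_inv_smul₀ two_ne_zero]
    rw [← LinearMap.comp_add, h3, ← LinearMap.comp_assoc, ← LinearMap.comp_assoc]
    change (momentMap h h' w * Z) * Q = Q
    rw [hYZ, one_mul]
  -- The adjoint of the previous identity: the sign from `adj_adj` cancels the one from skewness of
  -- `Q`.
  have h4 : adj h h' b ∘ₗ w + adj h h' b ∘ₗ w = Q := by
    have := congrArg (adj h h) h2
    rw [adj_add, adj_comp h h' h, adj_adj, LinearMap.comp_neg, hQU, ← neg_add] at this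
    exact neg_injective this
  have h5 : adj h h' w ∘ₗ b = adj h h' b ∘ₗ w := by
    have := h2.trans h4.symm
    rw [← two_smul F, ← two_smul F (adj h h' b ∘ₗ w)] at this
    exact smul_right_injective _ two_ne_zero this
  rw [← sub_eq_iff_eq_add', momentMap_add_sub, ← h5, h2, hQ, sub_add_cancel]

theorem bijective_of_shiftsLattices (hdim : Module.finrank Dᵐᵒᵖ V' = Module.finrank Dᵐᵒᵖ V)
    (hL : ∀ x, ∃ t, x ∈ L t) {r : ℝ} {w : V →ₗ[Dᵐᵒᵖ] V'}
    (hY : ShiftsLattices L (momentMap h h' w) r) : Function.Bijective w := by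
  have hwi : Function.Injective w :=
    Function.Injective.of_comp (f := adj h h' w) (hY.bijective hL).injective
  exact ⟨hwi, (LinearMap.injective_iff_surjective_of_finrank_eq_finrank hdim.symm).1 hwi⟩

/-- If `M(w)` shifts the lattices by `-2s`, then `w` maps `L (u + s)` onto `L' u`. -/
theorem exists_apply_eq_of_mem (hdim : Module.finrank Dᵐᵒᵖ V' = Module.finrank Dᵐᵒᵖ V)
    (hL : IsSelfDualLatticeFunction F h L) (hL' : IsSelfDualLatticeFunction F h' L')
    {r s : ℝ} (hrs : r = s + s) {w : V →ₗ[Dᵐᵒᵖ] V'} (hw : w ∈ homLattice L L' (-s))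
    (hY : ShiftsLattices L (momentMap h h' w) r) {u : ℝ} {y : V'} (hy : y ∈ L' u) :
    ∃ x ∈ L (u + s), w x = y := by
  have hYb := hY.bijective hL.isLatticeFunction.exhaustive
  -- Here `w⋆y ∈ L (u - s)` equals `M(w) x` with `x ∈ L (u + s)`. Writing `y = w z` gives `M(w) z =
  -- M(w) x`, so `z = x`.
  obtain ⟨x, hx, hxy⟩ := hY.exists_preimage _ _ (adj_mem_homLattice hL hL' hw u y hy)
  refine ⟨x, by convert hx using 2; linarith, ?_⟩
  obtain ⟨z, rfl⟩ :=
    (bijective_of_shiftsLattices hdim hL.isLatticeFunction.exhaustive hY).surjective y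
  rw [hYb.injective hxy]

end MomentMap

/-! ### The main theorem -/

theorem lieFiltrationPlus_exists {D : Type*} [DivisionRing D] {τ : D → D} {ε : ℤˣ}
    {V : Type*} [AddCommGroup V] [Module Dᵐᵒᵖ V] [Module.Finite Dᵐᵒᵖ V] {h : HermForm τ ε V}
    {L : ℝ → AddSubgroup V} {t : ℝ} {X : Module.End Dᵐᵒᵖ V} :
    X ∈ lieFiltrationPlus h L t ↔ ∃ u > t, X ∈ lieFiltration h L u := by
  simp only [lieFiltrationPlus, Set.mem_iUnion, exists_prop]

theorem homLatticePlus_exists {D : Type*} [DivisionRing D]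
    {V : Type*} [AddCommGroup V] [Module Dᵐᵒᵖ V] {V' : Type*} [AddCommGroup V'] [Module Dᵐᵒᵖ V']
    {L : ℝ → AddSubgroup V} {L' : ℝ → AddSubgroup V'} {t : ℝ} {w : V →ₗ[Dᵐᵒᵖ] V'} :
    w ∈ homLatticePlus L L' t ↔ ∃ u > t, w ∈ homLattice L L' u := by
  simp only [homLatticePlus, Set.mem_iUnion, exists_prop]

theorem IsTypeOneInvolution.map_zero {F : Type*} [Field F] {D : Type*} [DivisionRing D]
    [Algebra F D] {τ : D → D} (hτ : IsTypeOneInvolution F τ) : τ 0 = 0 := by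
  simpa using hτ.map_add 0 0

theorem IsTypeOneInvolution.finrank_ne_zero {F : Type*} [Field F] {D : Type*} [DivisionRing D]
    [Algebra F D] {τ : D → D} (hτ : IsTypeOneInvolution F τ) : Module.finrank F D ≠ 0 := by
  rcases hτ.cases with h | ⟨h, -⟩ | ⟨h, -⟩ <;> simp [h]

theorem finite_of_finite_op {F : Type*} [Field F] {D : Type*} [DivisionRing D] [Algebra F D]
    (hD : Module.finrank F D ≠ 0) (V : Type*) [AddCommGroup V] [Module Dᵐᵒᵖ V] [Module F V]
    [IsScalarTower F Dᵐᵒᵖ V] [Module.Finite Dᵐᵒᵖ V] : Module.Finite F V := by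
  have : Module.Finite F D := Module.finite_of_finrank_pos (Nat.pos_of_ne_zero hD)
  have : Module.Finite F Dᵐᵒᵖ := Module.Finite.equiv (opLinearEquiv F)
  exact Module.Finite.trans Dᵐᵒᵖ V

theorem mainTheorem9
    {F : Type*} [NontriviallyNormedField F] [IsUltrametricDist F] [LocallyCompactSpace F]
    [CharZero F] (hp : ‖(2 : F)‖ = 1)
    {D : Type*} [DivisionRing D] [Algebra F D] {τ : D → D} (hτ : IsTypeOneInvolution F τ)
    (ε : ℤˣ)
    {V : Type*} [AddCommGroup V] [Module Dᵐᵒᵖ V] [Module F V] [IsScalarTower F Dᵐᵒᵖ V]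
    [Module.Finite Dᵐᵒᵖ V] (h : HermForm τ ε V)
    (Γ : Module.End Dᵐᵒᵖ V) (hΓ : Γ ∈ lieU h)
    (hss : Module.End.IsSemisimple (LinearMap.restrictScalars F Γ))
    (r : ℝ) (hr : 0 < r) (hblock : IsSingleBlock F Γ r)
    (L : ℝ → AddSubgroup V) (hL : IsSelfDualLatticeFunction F h L)
    (hLΓ : IsGammaLatticeFunction F Γ L) :
    ∃ hu : IsUnit Γ,
    ∀ (V' : Type*) [AddCommGroup V'] [Module Dᵐᵒᵖ V'] [Module.Finite Dᵐᵒᵖ V']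
      (h' : HermForm τ (-ε) V'),
      -- surjectivity of the moment map, for real indices `t` and for indices `t⁺`
      (Module.finrank Dᵐᵒᵖ V' = Module.finrank Dᵐᵒᵖ V →
        ∀ L' : ℝ → AddSubgroup V', IsSelfDualLatticeFunction F h' L' →
        ∀ w ∈ homLattice L L' (-(r / 2)),
          momentMap h h' w - Γ ∈ lieFiltrationPlus h L (-r) →
          (∀ t : ℝ, -(r / 2) < t →
            momentMap h h' '' {w' | w' - w ∈ homLattice L L' t} =
              {X | X - momentMap h h' w ∈ lieFiltration h L (-(r / 2) + t)}) ∧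
          (∀ t : ℝ, -(r / 2) ≤ t →
            momentMap h h' '' {w' | w' - w ∈ homLatticePlus L L' t} =
              {X | X - momentMap h h' w ∈ lieFiltrationPlus h L (-(r / 2) + t)})) ∧
      -- the self-dual lattice functions in question form one orbit of `U(V')`
      (Module.finrank Dᵐᵒᵖ V' = Module.finrank Dᵐᵒᵖ V →
        (∃ w : V →ₗ[Dᵐᵒᵖ] V', momentMap h h' w - Γ ∈ lieFiltrationPlus h L (-r)) →
        ∃ L₀ : ℝ → AddSubgroup V', IsSelfDualLatticeFunction F h' L₀ ∧
          {L' : ℝ → AddSubgroup V' | IsSelfDualLatticeFunction F h' L' ∧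
            ∃ w ∈ homLattice L L' (-(r / 2)),
              momentMap h h' w - Γ ∈ lieFiltrationPlus h L (-r)} =
          {L' : ℝ → AddSubgroup V' | ∃ g ∈ unitarySet h',
            L' = fun t => (L₀ t).map (g : V' →ₗ[Dᵐᵒᵖ] V').toAddMonoidHom}) ∧
      -- the spaces of equal dimension on which the condition can be met
      ((Module.finrank Dᵐᵒᵖ V' = Module.finrank Dᵐᵒᵖ V ∧
          ∃ w : V →ₗ[Dᵐᵒᵖ] V', momentMap h h' w - Γ ∈ lieFiltrationPlus h L (-r)) ↔
        Isometric (gammaForm h hΓ hu) h') := by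
  have hD := hτ.finrank_ne_zero
  have hτ0 := hτ.map_zero
  have : ProperSpace F := ProperSpace.of_locallyCompactSpace F
  have : Module.Finite F V := finite_of_finite_op hD V
  have hLF := hL.isValuedFiltration hD hτ0
  have hΓL := homLattice_gamma hblock hLΓ
  obtain ⟨Δ, hΔ, hΓΔ, hΔΓ⟩ := exists_inverse_gamma hblock hLΓ
  have hrs : r = r / 2 + r / 2 := (add_halves r).symm
  refine ⟨⟨⟨Γ, Δ, hΓΔ, hΔΓ⟩, rfl⟩, fun V' _ _ _ h' => ?_⟩
  -- The space `V'` carries only its `D`-structure; the completeness arguments use the restriction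
  -- to `F`.
  let : Module F V' := Module.compHom V' (algebraMap F Dᵐᵒᵖ)
  have : IsScalarTower F Dᵐᵒᵖ V' := ⟨fun a d v => by
    rw [Algebra.smul_def, mul_smul]
    rfl⟩
  have : Module.Finite F V' := finite_of_finite_op hD V'
  have hshift : ∀ w : V →ₗ[Dᵐᵒᵖ] V', momentMap h h' w - Γ ∈ lieFiltrationPlus h L (-r) →
      ShiftsLattices L (momentMap h h' w) r := by
    intro w hw
    obtain ⟨c, hc, hw⟩ := lieFiltrationPlus_exists.1 hw
    exact ShiftsLattices.perturb hLF hΓL hΔ hΓΔ hc hw.2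
  have hexact : ∀ L' : ℝ → AddSubgroup V', IsSelfDualLatticeFunction F h' L' →
      ∀ w ∈ homLattice L L' (-(r / 2)), momentMap h h' w - Γ ∈ lieFiltrationPlus h L (-r) →
      ∃ e ∈ homLattice L L' (-(r / 2)), momentMap h h' e = Γ := by
    intro L' hL' w hw hwΓ
    obtain ⟨c, hc, hwc⟩ := lieFiltrationPlus_exists.1 hwΓ
    -- Surjectivity is applied at `t = c + r / 2`, which exceeds `-r / 2` because `c > -r`.
    have hX : Γ - momentMap h h' w ∈ lieFiltration h L (-(r / 2) + (c + r / 2)) := by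
      refine ⟨sub_mem_lieU hΓ (momentMap_mem_lieU h h' w), ?_⟩
      have := neg_mem_homLattice hwc.2
      rw [neg_sub] at this
      convert this using 2
      ring
    obtain ⟨b, hb, hwb⟩ := exists_momentMap_add_eq hp hD hτ0 hL hL' hrs (by linarith) hw
      (hshift w hwΓ) hX
    exact ⟨w + b, add_mem_homLattice hw
      (homLattice_mono hL'.isLatticeFunction.antitone (by linarith) hb), by
        rw [hwb, add_sub_cancel]⟩
  have hzero : (0 : Module.End Dᵐᵒᵖ V) ∈ lieFiltrationPlus h L (-r) := by
    refine lieFiltrationPlus_exists.2 ⟨-r + 1, by simp, ?_, fun _ _ _ => zero_mem _⟩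
    have := sub_mem_lieU hΓ hΓ
    rwa [sub_self] at this
  have hself : ∀ e : V →ₗ[Dᵐᵒᵖ] V', Module.finrank Dᵐᵒᵖ V' = Module.finrank Dᵐᵒᵖ V →
      momentMap h h' e - Γ ∈ lieFiltrationPlus h L (-r) → Function.Bijective e ∧
      IsSelfDualLatticeFunction F h' (fun u => (L (u + r / 2)).map e.toAddMonoidHom) ∧
      e ∈ homLattice L (fun u => (L (u + r / 2)).map e.toAddMonoidHom) (-(r / 2)) := by
    intro e hdim heΓ
    have hb := bijective_of_shiftsLattices hdim hLF.exhaustive (hshift e heΓ)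
    refine ⟨hb, hL.map_shift hb hrs (hshift e heΓ), fun u x hx => ⟨x, ?_, rfl⟩⟩
    simpa using hx
  have hexists : Module.finrank Dᵐᵒᵖ V' = Module.finrank Dᵐᵒᵖ V →
      (∃ w : V →ₗ[Dᵐᵒᵖ] V', momentMap h h' w - Γ ∈ lieFiltrationPlus h L (-r)) →
      ∃ e : V →ₗ[Dᵐᵒᵖ] V', momentMap h h' e = Γ := by
    rintro hdim ⟨w, hw⟩
    obtain ⟨-, h1, h2⟩ := hself w hdim hw
    obtain ⟨e, -, he⟩ := hexact _ h1 w h2 hw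
    exact ⟨e, he⟩
  refine ⟨fun _ L' hL' w hw hwΓ => ?_, fun hdim hw => ?_, ?_, ?_⟩
  · have hsub : ∀ t w', -(r / 2) ≤ t → w' - w ∈ homLattice L L' t →
        momentMap h h' w' - momentMap h h' w ∈ lieFiltration h L (-(r / 2) + t) := by
      intro t w' ht hw'
      have := momentMap_add_sub_mem hL hL' ht hw hw'
      rwa [add_sub_cancel] at this
    have hsurj : ∀ t X, -(r / 2) < t → X - momentMap h h' w ∈ lieFiltration h L (-(r / 2) + t) →
        ∃ w', w' - w ∈ homLattice L L' t ∧ momentMap h h' w' = X := by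
      intro t X ht hX
      obtain ⟨b, hb, hwb⟩ := exists_momentMap_add_eq hp hD hτ0 hL hL' hrs ht hw (hshift w hwΓ) hX
      exact ⟨w + b, by rwa [add_sub_cancel_left], by rw [hwb, add_sub_cancel]⟩
    constructor
    · intro t ht
      ext X
      constructor
      · rintro ⟨w', hw', rfl⟩
        exact hsub t w' ht.le hw'
      · exact hsurj t X ht
    · intro t ht
      ext X
      constructor
      · rintro ⟨w', hw', rfl⟩
        obtain ⟨u, hu, hw'⟩ := homLatticePlus_exists.1 hw'
        exact lieFiltrationPlus_exists.2 ⟨_, by linarith, hsub u w' (by linarith) hw'⟩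
      · intro hX
        obtain ⟨u, hu, hX⟩ := lieFiltrationPlus_exists.1 hX
        -- Since `u > -r / 2 + t`, the index `u + r / 2` is strictly above `-r / 2` even in the
        -- boundary case `t = -r / 2`.
        obtain ⟨w', hw', rfl⟩ := hsurj (u + r / 2) X (by linarith) (by
          convert hX using 2
          ring)
        exact ⟨w', homLatticePlus_exists.2 ⟨_, by linarith, hw'⟩, rfl⟩
  · obtain ⟨e, he⟩ := hexists hdim hw
    have heΓ : momentMap h h' e - Γ ∈ lieFiltrationPlus h L (-r) := by rwa [he, sub_self]
    obtain ⟨heb, hL₀, heL⟩ := hself e hdim heΓ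
    refine ⟨_, hL₀, ?_⟩
    ext L'
    constructor
    · rintro ⟨hL', w, hw, hwΓ⟩
      obtain ⟨f, hf, hfΓ⟩ := hexact L' hL' w hw hwΓ
      let i := LinearEquiv.ofBijective e heb
      have hi : ∀ x, i.symm (e x) = x := i.symm_apply_apply
      -- Both `e` and `f` pull the form of `V'` back to that of `V_Γ`, so `f e⁻¹` is an isometry of
      -- `V'`; it carries `e (L (u + s))` to `f (L (u + s)) = L' u`.
      refine ⟨f ∘ₗ i.symm.toLinearMap, mem_unitarySet_of_forall fun x y => ?_, ?_⟩
      · obtain ⟨x, rfl⟩ := heb.surjective x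
        obtain ⟨y, rfl⟩ := heb.surjective y
        simp only [LinearMap.comp_apply, LinearEquiv.coe_coe, hi]
        rw [form_momentMap h h', form_momentMap h h', he, hfΓ]
      · funext u
        ext y
        constructor
        · intro hy
          obtain ⟨x, hx, rfl⟩ := exists_apply_eq_of_mem hdim hL hL' hrs hf
            (hshift f (by rwa [hfΓ, sub_self])) hy
          exact ⟨e x, ⟨x, hx, rfl⟩, congrArg f (hi x)⟩
        · rintro ⟨_, ⟨x, hx, rfl⟩, rfl⟩
          have := hf _ x hx
          rw [add_neg_cancel_right] at this
          have h2 : f (i.symm (e x)) ∈ L' u := by rwa [hi]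
          exact h2
    · rintro ⟨g, hg, rfl⟩
      -- The translate by `g` is the lattice function attached to `g e`, which has the same moment
      -- `Γ`.
      have hgΓ : momentMap h h' (g ∘ₗ e) = Γ := momentMap_eq_of_forall fun x y => by
        rw [LinearMap.comp_apply, LinearMap.comp_apply, form_of_mem_unitarySet hg,
          form_momentMap h h', he]
      have hgeΓ : momentMap h h' (g ∘ₗ e) - Γ ∈ lieFiltrationPlus h L (-r) := by
        rwa [hgΓ, sub_self]
      obtain ⟨-, h1, h2⟩ := hself _ hdim hgeΓ
      have hmap : (fun u => (L (u + r / 2)).map (g ∘ₗ e).toAddMonoidHom) = fun u =>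
          ((L (u + r / 2)).map e.toAddMonoidHom).map (g : V' →ₗ[Dᵐᵒᵖ] V').toAddMonoidHom := by
        funext u
        rw [AddSubgroup.map_map]
        rfl
      rw [hmap] at h1 h2
      exact ⟨h1, g ∘ₗ e, h2, hgeΓ⟩
  · rintro ⟨hdim, hw⟩
    obtain ⟨e, he⟩ := hexists hdim hw
    have heb := (hself e hdim (by rwa [he, sub_self])).1
    refine ⟨LinearEquiv.ofBijective e heb, fun x y => ?_⟩
    change h'.form (e x) (e y) = h.form x (Γ y)
    rw [form_momentMap h h', he]
  · rintro ⟨e, he⟩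
    refine ⟨e.finrank_eq.symm, e.toLinearMap, ?_⟩
    have : momentMap h h' e.toLinearMap = Γ := momentMap_eq_of_forall he
    rwa [this, sub_self]
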